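/- An orthomodular lattice (OML) is a bounded lattice $L$ with an order-reversing involution $a\mapsto a'$ such that $a\wedge a'=0$ and $a\vee a'=1$ for all $a$, and $b=a\vee(a'\wedge b)$ whenever $a\le b$. A subalgebra of $L$ is a subset containing $0,1$ and closed under $\vee$, $\wedge$ and $'$; it is Boolean if it is a Boolean algebra (equivalently, distributive) under the inherited operations. Let $\mathrm{Sub}(L)$ be the lattice of all subalgebras of $L$ and $\mathrm{BSub}(L)$ the poset of all Boolean subalgebras of $L$, both ordered by inclusion. Let $L$ and $M$ be non-trivial OMLs (i.e. each has at least two elements). Then 1. $\mathrm{BSub}(L)$ and $\mathrm{BSub}(M)$ are isomorphic as posets if and only if $L$ and $M$ are isomorphic as OMLs; 2. $\mathrm{Sub}(L)$ and $\mathrm{Sub}(M)$ are isomorphic as lattices if and only if $L$ and $M$ are isomorphic as OMLs; 3. consequently, $\mathrm{BSub}(L)\cong\mathrm{BSub}(M)$ as posets if and only if $\mathrm{Sub}(L)\cong\mathrm{Sub}(M)$ as lattices. -/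

import Mathlib

/-- An orthomodular lattice: a bounded lattice with an order-reversing involution `a ↦ aᶜ` that is
a complementation, satisfying the orthomodular law. -/
class OrthomodularLattice (L : Type*) extends Lattice L, BoundedOrder L, Compl L where
  compl_compl' : ∀ a : L, aᶜᶜ = a
  compl_antitone' : ∀ a b : L, a ≤ b → bᶜ ≤ aᶜ
  inf_compl' : ∀ a : L, a ⊓ aᶜ = ⊥
  sup_compl' : ∀ a : L, a ⊔ aᶜ = ⊤
  orthomodular : ∀ a b : L, a ≤ b → b = a ⊔ (aᶜ ⊓ b)

namespace OrthomodularLattice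

/-- An isomorphism of orthomodular lattices: an order isomorphism (equivalently, a bijection
preserving binary joins and meets; it then preserves the bounds) preserving orthocomplements. -/
structure Iso (L M : Type*) [OrthomodularLattice L] [OrthomodularLattice M]
    extends L ≃o M where
  map_compl' : ∀ a : L, toFun aᶜ = (toFun a)ᶜ

/-- `Subalg L`: the subalgebras of an orthomodular lattice, i.e. the subsets that contain both bounds
and are closed under joins, meets and orthocomplements. -/
@[ext]
structure Subalg (L : Type*) [OrthomodularLattice L] where
  carrier : Set L
  bot_mem' : ⊥ ∈ carrier
  top_mem' : ⊤ ∈ carrier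
  sup_mem' : ∀ {a b : L}, a ∈ carrier → b ∈ carrier → a ⊔ b ∈ carrier
  inf_mem' : ∀ {a b : L}, a ∈ carrier → b ∈ carrier → a ⊓ b ∈ carrier
  compl_mem' : ∀ {a : L}, a ∈ carrier → aᶜ ∈ carrier

namespace Subalg

variable {L : Type*} [OrthomodularLattice L]

instance : SetLike (Subalg L) L where
  coe S := S.carrier
  coe_injective _ _ h := Subalg.ext h

/-- Subalgebras are ordered by inclusion. -/
instance : PartialOrder (Subalg L) := .ofSetLike (Subalg L) L

/-- Infima of subalgebras are intersections. -/
instance : InfSet (Subalg L) where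
  sInf 𝒮 :=
    { carrier := {a | ∀ S ∈ 𝒮, a ∈ S}
      bot_mem' := fun S _ => S.bot_mem'
      top_mem' := fun S _ => S.top_mem'
      sup_mem' := fun ha hb S hS => S.sup_mem' (ha S hS) (hb S hS)
      inf_mem' := fun ha hb S hS => S.inf_mem' (ha S hS) (hb S hS)
      compl_mem' := fun ha S hS => S.compl_mem' (ha S hS) }

/-- The lattice structure of `Subalg L` for the inclusion order. -/
instance : CompleteLattice (Subalg L) :=
  completeLatticeOfInf (Subalg L) fun _ =>
    ⟨fun S hS _ ha => ha S hS, fun _ hT _ ha S hS => hT hS ha⟩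

/-- A subalgebra is Boolean if, with the inherited operations, it is a Boolean algebra. As it is
already a complemented bounded lattice, this means that it is distributive. -/
def IsBoolean (S : Subalg L) : Prop :=
  ∀ a ∈ S, ∀ b ∈ S, ∀ c ∈ S, a ⊓ (b ⊔ c) = (a ⊓ b) ⊔ (a ⊓ c)

end Subalg

/-- `BSub L`: the poset of Boolean subalgebras of `L`, ordered by inclusion. -/
abbrev BSub (L : Type*) [OrthomodularLattice L] : Type _ :=
  {S : Subalg L // S.IsBoolean}

end OrthomodularLattice

/-! The three equivalences close up through the cycle from isomorphic `BSub` to isomorphic algebras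
to isomorphic `Subalg` and back to isomorphic `BSub`. The middle implication is transport of
structure; the other two carry the content.

From `Subalg` to `BSub`, Boolean subalgebras are recognised by the order. The atoms are the sets
`{⊥, ⊤, a, aᶜ}`. In a Boolean subalgebra the symmetric difference of `a` and `b` gives a third atom,
any two of the three generating the remaining one. Conversely, every element generated by `a` and
`b` is compatible with `a` or with `b` (`compatible_or_compatible_of_mem_sup`), so a third atom
forces `a` and `b` themselves to be compatible, and pairwise compatibility implies distributivity.

From `BSub` to the algebra, the atoms of `BSub` determine elements up to swapping `a` and `aᶜ`. A
cover of `four a` is an eight-element algebra in which exactly one of `a`, `aᶜ` is an atom. Two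
distinct covers disagree on which one precisely when they have an upper bound containing no other
cover of `four a` (`Opposite`). Hence an order isomorphism respects these orientations after one
choice for each pair `{a, aᶜ}`. Order is then recovered because `a < b` makes `a` and `bᶜ` distinct
atoms of one eight-element algebra, and such atoms are orthogonal. Nontriviality is essential: the
one- and two-element algebras both have a single subalgebra. -/

namespace OrthomodularLattice

/-! ### Orthomodular arithmetic -/

section Basic

variable {L : Type*} [OrthomodularLattice L]

@[simp] theorem oml_compl_compl (a : L) : aᶜᶜ = a := compl_compl' a

theorem oml_compl_le {a b : L} (h : a ≤ b) : bᶜ ≤ aᶜ := compl_antitone' a b h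

theorem oml_le_compl_comm {a b : L} : a ≤ bᶜ ↔ b ≤ aᶜ :=
  ⟨fun h => by simpa using oml_compl_le h, fun h => by simpa using oml_compl_le h⟩

theorem oml_compl_sup (a b : L) : (a ⊔ b)ᶜ = aᶜ ⊓ bᶜ :=
  le_antisymm (le_inf (oml_compl_le le_sup_left) (oml_compl_le le_sup_right))
    (oml_le_compl_comm.1 (sup_le (oml_le_compl_comm.1 inf_le_left)
      (oml_le_compl_comm.1 inf_le_right)))

theorem oml_compl_inf (a b : L) : (a ⊓ b)ᶜ = aᶜ ⊔ bᶜ := by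
  rw [← oml_compl_compl (aᶜ ⊔ bᶜ), oml_compl_sup, oml_compl_compl, oml_compl_compl]

@[simp] theorem oml_inf_compl (a : L) : a ⊓ aᶜ = ⊥ := inf_compl' a

@[simp] theorem oml_sup_compl (a : L) : a ⊔ aᶜ = ⊤ := sup_compl' a

@[simp] theorem oml_compl_inf_self (a : L) : aᶜ ⊓ a = ⊥ := by rw [inf_comm, oml_inf_compl]

@[simp] theorem oml_compl_sup_self (a : L) : aᶜ ⊔ a = ⊤ := by rw [sup_comm, oml_sup_compl]

@[simp] theorem oml_compl_bot : (⊥ : L)ᶜ = ⊤ := by simpa using oml_sup_compl (⊥ : L)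

@[simp] theorem oml_compl_top : (⊤ : L)ᶜ = ⊥ := by simpa using oml_inf_compl (⊤ : L)

theorem oml_compl_inj {a b : L} (h : aᶜ = bᶜ) : a = b := by
  rw [← oml_compl_compl a, h, oml_compl_compl]

theorem eq_bot_of_le_of_le_compl {p x : L} (h : p ≤ x) (h' : p ≤ xᶜ) : p = ⊥ :=
  le_bot_iff.1 ((le_inf h h').trans_eq (oml_inf_compl x))

theorem eq_top_of_le_of_compl_le {p x : L} (h : p ≤ x) (h' : pᶜ ≤ x) : x = ⊤ :=
  top_le_iff.1 ((oml_sup_compl p).symm.le.trans (sup_le h h'))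

theorem eq_of_le_of_inf_compl {a b : L} (h : a ≤ b) (h' : b ⊓ aᶜ = ⊥) : b = a := by
  rw [orthomodular a b h, inf_comm, h', sup_bot_eq]

theorem sup_compl_inf_of_le {a b : L} (h : a ≤ b) : a ⊔ (aᶜ ⊓ b) = b := (orthomodular a b h).symm

/-- The dual orthomodular law, for orthogonal elements. -/
theorem sup_inf_compl_of_le_compl {p q : L} (h : p ≤ qᶜ) : (p ⊔ q) ⊓ qᶜ = p := by
  have := sup_compl_inf_of_le (oml_le_compl_comm.1 h)
  apply oml_compl_inj
  rw [oml_compl_inf, oml_compl_sup, oml_compl_compl, sup_comm]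
  rwa [inf_comm] at this

end Basic

/-! ### Boolean subalgebras cut out by a set of test elements -/

namespace Subalg

variable {L : Type*} [OrthomodularLattice L]

/-- The subalgebra of those elements that decide every member of `P`. -/
def decides (P : Set L) : Subalg L where
  carrier := {x | ∀ p ∈ P, p ≤ x ∨ p ≤ xᶜ}
  bot_mem' p _ := Or.inr (by simp)
  top_mem' p _ := Or.inl le_top
  sup_mem' {a b} ha hb p hp := by
    rcases ha p hp with h | h
    · exact Or.inl (h.trans le_sup_left)
    · rcases hb p hp with h' | h'
      · exact Or.inl (h'.trans le_sup_right)
      · exact Or.inr (by rw [oml_compl_sup]; exact le_inf h h')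
  inf_mem' {a b} ha hb p hp := by
    rcases ha p hp with h | h
    · rcases hb p hp with h' | h'
      · exact Or.inl (le_inf h h')
      · exact Or.inr (h'.trans (oml_compl_le inf_le_right))
    · exact Or.inr (h.trans (oml_compl_le inf_le_left))
  compl_mem' {a} ha p hp := by simpa [or_comm] using ha p hp

theorem bot_mem (S : Subalg L) : ⊥ ∈ S := S.bot_mem'
theorem top_mem (S : Subalg L) : ⊤ ∈ S := S.top_mem'
theorem sup_mem {S : Subalg L} {a b : L} (ha : a ∈ S) (hb : b ∈ S) : a ⊔ b ∈ S := S.sup_mem' ha hb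
theorem inf_mem {S : Subalg L} {a b : L} (ha : a ∈ S) (hb : b ∈ S) : a ⊓ b ∈ S := S.inf_mem' ha hb
theorem compl_mem {S : Subalg L} {a : L} (ha : a ∈ S) : aᶜ ∈ S := S.compl_mem' ha

theorem mem_of_compl_mem {S : Subalg L} {a : L} (ha : aᶜ ∈ S) : a ∈ S := by
  simpa using compl_mem ha

/-- The defect `z` of distributivity is again decided by each `p ∈ P`. If `p ≤ z`, deciding `b` and
`c` forces `p = ⊥`; so every `p` lies below `zᶜ`, and `zᶜ = ⊤`. -/
theorem isBoolean_decides {P : Set L} (hP : ∀ w, (∀ p ∈ P, p ≤ w) → w = ⊤) :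
    (decides P).IsBoolean := by
  intro a ha b hb c hc
  refine eq_of_le_of_inf_compl (sup_le (inf_le_inf_left a le_sup_left)
    (inf_le_inf_left a le_sup_right)) ?_
  set z := a ⊓ (b ⊔ c) ⊓ (a ⊓ b ⊔ a ⊓ c)ᶜ with hz
  have hzm : z ∈ decides P :=
    inf_mem (inf_mem ha (sup_mem hb hc)) (compl_mem (sup_mem (inf_mem ha hb) (inf_mem ha hc)))
  suffices zᶜ = ⊤ by rw [← oml_compl_compl z, this, oml_compl_top]
  refine hP _ fun p hp => (hzm p hp).elim (fun h => ?_) id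
  have hpa : p ≤ a := h.trans (inf_le_left.trans inf_le_left)
  have hpbc : p ≤ b ⊔ c := h.trans (inf_le_left.trans inf_le_right)
  have hpr : p ≤ (a ⊓ b ⊔ a ⊓ c)ᶜ := h.trans inf_le_right
  suffices p = ⊥ by rw [this]; exact bot_le
  rcases hb p hp with h1 | h1
  · exact eq_bot_of_le_of_le_compl ((le_inf hpa h1).trans le_sup_left) hpr
  · rcases hc p hp with h2 | h2
    · exact eq_bot_of_le_of_le_compl ((le_inf hpa h2).trans le_sup_right) hpr
    · exact eq_bot_of_le_of_le_compl hpbc (by rw [oml_compl_sup]; exact le_inf h1 h2)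

/-- A Boolean subalgebra as a Boolean algebra. -/
abbrev IsBoolean.toBooleanAlgebra {S : Subalg L} (hS : S.IsBoolean) : BooleanAlgebra S where
  sup a b := ⟨a ⊔ b, sup_mem a.2 b.2⟩
  inf a b := ⟨a ⊓ b, inf_mem a.2 b.2⟩
  compl a := ⟨(a : L)ᶜ, compl_mem a.2⟩
  top := ⟨⊤, S.top_mem⟩
  bot := ⟨⊥, S.bot_mem⟩
  le a b := (a : L) ≤ b
  lt a b := (a : L) < b
  lt_iff_le_not_ge a b := lt_iff_le_not_ge (a := (a : L))
  le_refl a := le_refl (a : L)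
  le_trans a b c := le_trans (a := (a : L))
  le_antisymm a b h h' := Subtype.ext (le_antisymm h h')
  le_sup_left a b := le_sup_left (a := (a : L))
  le_sup_right a b := le_sup_right (a := (a : L))
  sup_le a b c := sup_le (a := (a : L))
  inf_le_left a b := inf_le_left (a := (a : L))
  inf_le_right a b := inf_le_right (a := (a : L))
  le_inf a b c h h' := le_inf (show (a : L) ≤ b from h) (show (a : L) ≤ c from h')
  le_sup_inf a b c := by
    have key := hS _ (sup_mem a.2 b.2) _ a.2 _ c.2
    have key' := hS _ c.2 _ a.2 _ b.2
    change ((a : L) ⊔ (b : L)) ⊓ ((a : L) ⊔ (c : L)) ≤ (a : L) ⊔ (b : L) ⊓ (c : L)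
    rw [key, inf_comm _ (c : L), key']
    refine sup_le (inf_le_right.trans le_sup_left) (sup_le (inf_le_right.trans le_sup_left) ?_)
    rw [inf_comm]; exact le_sup_right
  le_top a := le_top (a := (a : L))
  bot_le a := bot_le (a := (a : L))
  inf_compl_le_bot a := (oml_inf_compl (a : L)).le
  top_le_sup_compl a := (oml_sup_compl (a : L)).symm.le

end Subalg

/-! ### Symmetric differences, compatibility and four-element subalgebras -/

open Subalg

variable {L : Type*} [OrthomodularLattice L]

/-- The symmetric difference in terms of the operations of an orthomodular lattice. -/
def omlSymmDiff (a b : L) : L := (a ⊓ bᶜ) ⊔ (b ⊓ aᶜ)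

theorem Subalg.omlSymmDiff_mem {S : Subalg L} {a b : L} (ha : a ∈ S) (hb : b ∈ S) :
    omlSymmDiff a b ∈ S :=
  sup_mem (inf_mem ha (compl_mem hb)) (inf_mem hb (compl_mem ha))

theorem omlSymmDiff_comm (a b : L) : omlSymmDiff a b = omlSymmDiff b a := sup_comm _ _

@[simp] theorem omlSymmDiff_bot (a : L) : omlSymmDiff a ⊥ = a := by simp [omlSymmDiff]

@[simp] theorem omlSymmDiff_top (a : L) : omlSymmDiff a ⊤ = aᶜ := by simp [omlSymmDiff]

theorem Subalg.IsBoolean.omlSymmDiff_cancel {S : Subalg L} (hS : S.IsBoolean) {a b : L}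
    (ha : a ∈ S) (hb : b ∈ S) : omlSymmDiff a (omlSymmDiff a b) = b := by
  let _ := hS.toBooleanAlgebra
  exact congrArg Subtype.val (symmDiff_symmDiff_cancel_left (⟨a, ha⟩ : S) ⟨b, hb⟩)

theorem Subalg.IsBoolean.inf_compl_inf {S : Subalg L} (hS : S.IsBoolean) {a b : L}
    (ha : a ∈ S) (hb : b ∈ S) : a ⊓ (a ⊓ b)ᶜ = a ⊓ bᶜ := by
  rw [oml_compl_inf, hS _ ha _ (compl_mem ha) _ (compl_mem hb), oml_inf_compl, bot_sup_eq]

theorem Subalg.IsBoolean.mono {S T : Subalg L} (hT : T.IsBoolean) (h : S ≤ T) : S.IsBoolean :=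
  fun a ha b hb c hc => hT a (h ha) b (h hb) c (h hc)

/-- Two elements are compatible if a Boolean subalgebra contains both. -/
def Compatible (a b : L) : Prop := ∃ S : Subalg L, S.IsBoolean ∧ a ∈ S ∧ b ∈ S

/-- The defect lies below `a` and is orthogonal to `a ⊓ b`, hence lies below `a ⊓ bᶜ`; likewise
below `cᶜ`. Being also below `b ⊔ c`, it vanishes. -/
theorem isBoolean_of_compatible {S : Subalg L} (h : ∀ a ∈ S, ∀ b ∈ S, Compatible a b) :
    S.IsBoolean := by
  intro a ha b hb c hc
  refine eq_of_le_of_inf_compl (sup_le (inf_le_inf_left a le_sup_left)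
    (inf_le_inf_left a le_sup_right)) ?_
  obtain ⟨T, hT, haT, hbT⟩ := h a ha b hb
  obtain ⟨U, hU, haU, hcU⟩ := h a ha c hc
  have e1 := hT.inf_compl_inf haT hbT
  have e2 := hU.inf_compl_inf haU hcU
  rw [oml_compl_sup]
  refine eq_bot_of_le_of_le_compl (x := b ⊔ c) (inf_le_left.trans inf_le_right) ?_
  rw [oml_compl_sup]
  refine le_inf ?_ ?_
  · exact (le_inf (inf_le_left.trans inf_le_left)
      (inf_le_right.trans inf_le_left)).trans (e1.le.trans inf_le_right)
  · exact (le_inf (inf_le_left.trans inf_le_left)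
      (inf_le_right.trans inf_le_right)).trans (e2.le.trans inf_le_right)

/-- The Boolean subalgebra `{⊥, ⊤, a, aᶜ}`. -/
def fourSub (a : L) : Subalg L := decides {a, aᶜ}

theorem isBoolean_fourSub (a : L) : (fourSub a).IsBoolean :=
  isBoolean_decides fun _ hw => eq_top_of_le_of_compl_le (hw a (by simp)) (hw aᶜ (by simp))

theorem mem_fourSub {a x : L} : x ∈ fourSub a ↔ x = ⊥ ∨ x = ⊤ ∨ x = a ∨ x = aᶜ := by
  constructor
  · intro h
    rcases h a (by simp) with h1 | h1 <;> rcases h aᶜ (by simp) with h2 | h2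
    · exact Or.inr (Or.inl (eq_top_of_le_of_compl_le h1 h2))
    · exact Or.inr (Or.inr (Or.inl (le_antisymm (by simpa using oml_compl_le h2) h1)))
    · exact Or.inr (Or.inr (Or.inr (le_antisymm (oml_le_compl_comm.1 h1) h2)))
    · left
      apply oml_compl_inj
      rw [eq_top_of_le_of_compl_le h1 h2, oml_compl_bot]
  · have ha : a ∈ fourSub a := by
      rintro p (rfl | rfl)
      exacts [Or.inl le_rfl, Or.inr le_rfl]
    rintro (rfl | rfl | rfl | rfl)
    exacts [bot_mem _, top_mem _, ha, compl_mem ha]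

theorem self_mem_fourSub (a : L) : a ∈ fourSub a := mem_fourSub.2 (by simp)

theorem fourSub_le {a : L} {S : Subalg L} : fourSub a ≤ S ↔ a ∈ S := by
  refine ⟨fun h => h (self_mem_fourSub a), fun ha x hx => ?_⟩
  rcases mem_fourSub.1 hx with rfl | rfl | rfl | rfl
  exacts [bot_mem _, top_mem _, ha, compl_mem ha]

theorem fourSub_compl (a : L) : fourSub aᶜ = fourSub a :=
  le_antisymm (fourSub_le.2 (compl_mem (self_mem_fourSub a)))
    (fourSub_le.2 (mem_of_compl_mem (self_mem_fourSub aᶜ)))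

theorem Subalg.mem_bot {x : L} : x ∈ (⊥ : Subalg L) ↔ x = ⊥ ∨ x = ⊤ := by
  constructor
  · intro h
    have : x ∈ fourSub (⊥ : L) := (bot_le : (⊥ : Subalg L) ≤ _) h
    simpa [mem_fourSub, or_comm, or_left_comm] using this
  · rintro (rfl | rfl)
    exacts [bot_mem _, top_mem _]

theorem fourSub_injective {a b : L} (hb : b ≠ ⊥) (hb' : b ≠ ⊤) (h : fourSub a = fourSub b) :
    b = a ∨ b = aᶜ := by
  have : b ∈ fourSub a := h ▸ self_mem_fourSub b
  simpa [mem_fourSub, hb, hb'] using this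

end OrthomodularLattice

/-! ### The lower commutator and two-generated subalgebras -/

namespace OrthomodularLattice

open Subalg

variable {L : Type*} [OrthomodularLattice L]

theorem compatible_of_mem_fourSub {a b : L} (h : b ∈ fourSub a) : Compatible a b :=
  ⟨fourSub a, isBoolean_fourSub a, self_mem_fourSub a, h⟩

/-- The four meets of `a` or `aᶜ` with `b` or `bᶜ`. -/
def meets (a b : L) : Set L := {a ⊓ b, a ⊓ bᶜ, aᶜ ⊓ b, aᶜ ⊓ bᶜ}

/-- The lower commutator of `a` and `b`. -/
def lowerComm (a b : L) : L := (a ⊓ b ⊔ a ⊓ bᶜ) ⊔ (aᶜ ⊓ b ⊔ aᶜ ⊓ bᶜ)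

theorem lowerComm_le_iff {a b w : L} : lowerComm a b ≤ w ↔ ∀ p ∈ meets a b, p ≤ w := by
  simp [lowerComm, meets, and_assoc]

theorem lowerComm_compl_left (a b : L) : lowerComm aᶜ b = lowerComm a b := by
  simp [lowerComm, sup_comm]

theorem lowerComm_comm (a b : L) : lowerComm b a = lowerComm a b := by
  simp only [lowerComm, inf_comm b, inf_comm bᶜ]
  exact sup_sup_sup_comm _ _ _ _

theorem lowerComm_compl_right (a b : L) : lowerComm a bᶜ = lowerComm a b := by
  rw [← lowerComm_comm, lowerComm_compl_left, lowerComm_comm]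

theorem left_mem_decides_meets (a b : L) : a ∈ decides (meets a b) := by
  rintro p (rfl | rfl | rfl | rfl) <;> simp

theorem right_mem_decides_meets (a b : L) : b ∈ decides (meets a b) := by
  rintro p (rfl | rfl | rfl | rfl) <;> simp

theorem lowerComm_mem_decides_meets (a b : L) : lowerComm a b ∈ decides (meets a b) :=
  fun p hp => Or.inl (lowerComm_le_iff.1 le_rfl p hp)

/-- A meet below the defect `z` also lies below `u ⊓ d`, so it is `⊥`. Thus all four meets are below
`zᶜ`, so `z ≤ u ⊓ dᶜ`, which is orthogonal to `z`. -/
theorem eq_sup_of_mem_decides_meets {a b u : L} (hu : u ∈ decides (meets a b)) :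
    u = (u ⊓ lowerComm a b) ⊔ (u ⊓ (lowerComm a b)ᶜ) := by
  set d := lowerComm a b with hd
  refine eq_of_le_of_inf_compl (sup_le inf_le_left inf_le_left) ?_
  set z := u ⊓ (u ⊓ d ⊔ u ⊓ dᶜ)ᶜ with hz
  have hzm : z ∈ decides (meets a b) := inf_mem hu (compl_mem (sup_mem
    (inf_mem hu (lowerComm_mem_decides_meets a b))
    (inf_mem hu (compl_mem (lowerComm_mem_decides_meets a b)))))
  have hdz : d ≤ zᶜ := by
    refine lowerComm_le_iff.2 fun p hp => (hzm p hp).elim (fun h => ?_) id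
    have hpd : p ≤ d := lowerComm_le_iff.1 le_rfl p hp
    have : p = ⊥ := eq_bot_of_le_of_le_compl (x := u ⊓ d ⊔ u ⊓ dᶜ)
      ((le_inf (h.trans inf_le_left) hpd).trans le_sup_left) (h.trans inf_le_right)
    rw [this]; exact bot_le
  exact eq_bot_of_le_of_le_compl (x := u ⊓ d ⊔ u ⊓ dᶜ)
    ((le_inf inf_le_left (oml_le_compl_comm.1 hdz)).trans le_sup_right) inf_le_right

theorem sup_lowerComm_eq {a b u : L} (hu : u ∈ decides (meets a b)) :
    u ⊔ lowerComm a b = u ⊓ (lowerComm a b)ᶜ ⊔ lowerComm a b := by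
  refine le_antisymm (sup_le ?_ le_sup_right) (sup_le (inf_le_left.trans le_sup_left) le_sup_right)
  conv_lhs => rw [eq_sup_of_mem_decides_meets hu]
  exact sup_le (inf_le_right.trans le_sup_right) le_sup_left

theorem inf_compl_lowerComm_congr {a b u v : L}
    (h : u ⊔ lowerComm a b = v ⊔ lowerComm a b) :
    uᶜ ⊓ (lowerComm a b)ᶜ = vᶜ ⊓ (lowerComm a b)ᶜ := by
  rw [← oml_compl_sup, h, oml_compl_sup]

theorem compl_sup_lowerComm_congr {a b u v : L} (hu : u ∈ decides (meets a b))
    (hv : v ∈ decides (meets a b)) (h : u ⊔ lowerComm a b = v ⊔ lowerComm a b) :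
    uᶜ ⊔ lowerComm a b = vᶜ ⊔ lowerComm a b := by
  rw [sup_lowerComm_eq (compl_mem hu), sup_lowerComm_eq (compl_mem hv),
    inf_compl_lowerComm_congr h]

/-- The complement of `a ⊔ b` is one of the four meets. Applied also to complements, this leaves
only six classes above the lower commutator in `commSub`. -/
theorem sup_sup_lowerComm (a b : L) : a ⊔ b ⊔ lowerComm a b = ⊤ := by
  refine eq_top_of_le_of_compl_le (p := a ⊔ b) le_sup_left ?_
  rw [oml_compl_sup]
  exact (lowerComm_le_iff.1 (le_refl (lowerComm a b)) (aᶜ ⊓ bᶜ) (by simp [meets])).trans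
    le_sup_right

/-- An element that agrees with a member of `fourSub a` above the lower commutator of `a` and `b`
is compatible with `a`. -/
theorem compatible_of_sup_lowerComm_eq {a b w m : L} (hw : w ∈ decides (meets a b))
    (hm : m ∈ fourSub a) (h : w ⊔ lowerComm a b = m ⊔ lowerComm a b) : Compatible a w := by
  set d := lowerComm a b with hd
  have had := left_mem_decides_meets a b
  have hmd : m ∈ decides (meets a b) := fourSub_le.2 had hm
  have e1 : wᶜ ⊓ dᶜ = mᶜ ⊓ dᶜ := inf_compl_lowerComm_congr h
  have e2 : w ⊓ dᶜ = m ⊓ dᶜ := by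
    simpa using inf_compl_lowerComm_congr (compl_sup_lowerComm_congr hw hmd h)
  -- The four meets cover `d`; the two added elements cover `dᶜ`. There `w` agrees with `m`, one of
  -- `⊥, ⊤, a, aᶜ`, so it decides them.
  have hP : ∀ x, (∀ p ∈ meets a b ∪ {a ⊓ dᶜ, aᶜ ⊓ dᶜ}, p ≤ x) → x = ⊤ := by
    intro x hx
    have hdx : d ≤ x := lowerComm_le_iff.2 fun p hp => hx p (Or.inl hp)
    have h1 : a ⊓ dᶜ ≤ x := hx _ (by simp)
    have h2 : aᶜ ⊓ dᶜ ≤ x := hx _ (by simp)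
    refine eq_top_of_le_of_compl_le (p := a) ?_ ?_
    · rw [eq_sup_of_mem_decides_meets had]
      exact sup_le (inf_le_right.trans hdx) h1
    · rw [eq_sup_of_mem_decides_meets (compl_mem had)]
      exact sup_le (inf_le_right.trans hdx) h2
  refine ⟨_, isBoolean_decides hP, ?_, ?_⟩
  · rintro p (hp | rfl | rfl)
    exacts [had p hp, Or.inl inf_le_left, Or.inr inf_le_left]
  · rintro p (hp | hp)
    · exact hw p hp
    · have hpd : p ≤ dᶜ := by rcases hp with rfl | rfl <;> exact inf_le_right
      have hpm : p ≤ m ∨ p ≤ mᶜ := by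
        rcases mem_fourSub.1 hm with rfl | rfl | rfl | rfl <;> rcases hp with rfl | rfl <;> simp
      rcases hpm with h' | h'
      · exact Or.inl ((le_inf h' hpd).trans (e2.symm.le.trans inf_le_left))
      · exact Or.inr ((le_inf h' hpd).trans (e1.symm.le.trans inf_le_left))

/-- Closure under meets follows from closure under joins and complements. -/
def Subalg.ofSupCompl (s : Set L) (bot_mem : ⊥ ∈ s) (top_mem : ⊤ ∈ s)
    (sup_mem : ∀ {a b : L}, a ∈ s → b ∈ s → a ⊔ b ∈ s)
    (compl_mem : ∀ {a : L}, a ∈ s → aᶜ ∈ s) : Subalg L where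
  carrier := s
  bot_mem' := bot_mem
  top_mem' := top_mem
  sup_mem' := sup_mem
  compl_mem' := compl_mem
  inf_mem' {a b} ha hb := by
    have h := compl_mem (sup_mem (compl_mem ha) (compl_mem hb))
    rwa [oml_compl_sup, oml_compl_compl, oml_compl_compl] at h

/-- A subalgebra containing `a` and `b` all of whose members agree, above the lower commutator of
`a` and `b`, with one of the six elements `⊥, ⊤, a, aᶜ, b, bᶜ`. -/
def commSub (a b : L) : Subalg L := Subalg.ofSupCompl
  {w | w ∈ decides (meets a b) ∧
    ∃ m, (m ∈ fourSub a ∨ m ∈ fourSub b) ∧ w ⊔ lowerComm a b = m ⊔ lowerComm a b}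
  ⟨bot_mem _, ⊥, Or.inl (bot_mem _), rfl⟩
  ⟨top_mem _, ⊤, Or.inl (top_mem _), rfl⟩
  (by
    rintro v w ⟨hv, m, hm, h⟩ ⟨hw, n, hn, h'⟩
    refine ⟨sup_mem hv hw, ?_⟩
    have e : v ⊔ w ⊔ lowerComm a b = m ⊔ n ⊔ lowerComm a b := by
      rw [sup_sup_distrib_right, h, h', ← sup_sup_distrib_right]
    have mixed : ∀ m ∈ fourSub a, ∀ n ∈ fourSub b, ∃ k, (k ∈ fourSub a ∨ k ∈ fourSub b) ∧
        m ⊔ n ⊔ lowerComm a b = k ⊔ lowerComm a b := by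
      intro m hm n hn
      have h1 := sup_sup_lowerComm a b
      have h2 := sup_sup_lowerComm aᶜ b
      have h3 := sup_sup_lowerComm a bᶜ
      have h4 := sup_sup_lowerComm aᶜ bᶜ
      simp only [lowerComm_compl_left, lowerComm_compl_right] at h2 h3 h4
      rcases mem_fourSub.1 hm with rfl | rfl | hm'
      · exact ⟨n, Or.inr hn, by simp⟩
      · exact ⟨⊤, Or.inr (top_mem _), by simp⟩
      · rcases mem_fourSub.1 hn with rfl | rfl | hn'
        · exact ⟨m, Or.inl hm, by simp⟩
        · exact ⟨⊤, Or.inr (top_mem _), by simp⟩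
        · refine ⟨⊤, Or.inr (top_mem _), ?_⟩
          rcases hm' with rfl | rfl <;> rcases hn' with rfl | rfl <;> simp [*]
    rw [e]
    rcases hm with hm | hm <;> rcases hn with hn | hn
    · exact ⟨_, Or.inl (sup_mem hm hn), rfl⟩
    · exact mixed m hm n hn
    · rw [sup_comm m]; exact mixed n hn m hm
    · exact ⟨_, Or.inr (sup_mem hm hn), rfl⟩)
  (by
    rintro w ⟨hw, m, hm, h⟩
    refine ⟨Subalg.compl_mem hw, mᶜ, hm.imp Subalg.compl_mem Subalg.compl_mem, compl_sup_lowerComm_congr hw ?_ h⟩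
    exact hm.elim (fun h => fourSub_le.2 (left_mem_decides_meets a b) h)
      (fun h => fourSub_le.2 (right_mem_decides_meets a b) h))

theorem left_mem_commSub (a b : L) : a ∈ commSub a b :=
  ⟨left_mem_decides_meets a b, a, Or.inl (self_mem_fourSub a), rfl⟩

theorem right_mem_commSub (a b : L) : b ∈ commSub a b :=
  ⟨right_mem_decides_meets a b, b, Or.inr (self_mem_fourSub b), rfl⟩

/-- Every element of the subalgebra generated by `a` and `b` is compatible with `a` or with `b`. -/
theorem compatible_or_compatible_of_mem_sup {a b w : L} (hw : w ∈ fourSub a ⊔ fourSub b) :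
    Compatible a w ∨ Compatible b w := by
  have hle : fourSub a ⊔ fourSub b ≤ commSub a b :=
    sup_le (fourSub_le.2 (left_mem_commSub a b)) (fourSub_le.2 (right_mem_commSub a b))
  obtain ⟨hwd, m, hm | hm, h⟩ := hle hw
  · exact Or.inl (compatible_of_sup_lowerComm_eq hwd hm h)
  · refine Or.inr (compatible_of_sup_lowerComm_eq (b := a) (m := m) ?_ hm ?_)
    · have e : meets b a = meets a b := by
        ext p
        simp only [meets, Set.mem_insert_iff, Set.mem_singleton_iff, inf_comm b, inf_comm bᶜ]
        tauto
      rwa [e]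
    · rwa [lowerComm_comm]

/-! ### Recognising Boolean subalgebras in the subalgebra lattice -/

theorem fourSub_eq_bot_iff {a : L} : fourSub a = ⊥ ↔ a = ⊥ ∨ a = ⊤ := by
  rw [← le_bot_iff, fourSub_le, Subalg.mem_bot]

theorem isAtom_subalg_iff {S : Subalg L} :
    IsAtom S ↔ ∃ a, a ≠ ⊥ ∧ a ≠ ⊤ ∧ S = fourSub a := by
  constructor
  · intro h
    have : ¬ S ≤ ⊥ := fun h' => h.1 (le_bot_iff.1 h')
    obtain ⟨a, ha, ha'⟩ := SetLike.not_le_iff_exists.1 this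
    rw [Subalg.mem_bot, not_or] at ha'
    refine ⟨a, ha'.1, ha'.2, ?_⟩
    refine ((h.le_iff.1 (fourSub_le.2 ha)).resolve_left ?_).symm
    rw [fourSub_eq_bot_iff]; tauto
  · rintro ⟨a, ha, ha', rfl⟩
    refine ⟨by rw [Ne, fourSub_eq_bot_iff]; tauto, fun T hT => ?_⟩
    by_contra hne
    have : ¬ T ≤ ⊥ := fun h' => hne (le_bot_iff.1 h')
    obtain ⟨x, hx, hx'⟩ := SetLike.not_le_iff_exists.1 this
    rw [Subalg.mem_bot, not_or] at hx'
    refine hT.not_ge (fourSub_le.2 ?_)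
    rcases mem_fourSub.1 (hT.le hx) with h | h | h | h
    · exact absurd h hx'.1
    · exact absurd h hx'.2
    · exact h ▸ hx
    · exact mem_of_compl_mem (h ▸ hx)

/-- A property of an element of a bounded lattice that, for a subalgebra, says that it is Boolean:
any two atoms `A ≠ B` below it have a third atom in general position in the join of `A` and `B`. -/
def HasThirdAtoms {α : Type*} [Lattice α] [OrderBot α] (S : α) : Prop :=
  ∀ A B : α, IsAtom A → IsAtom B → A ≤ S → B ≤ S → A ≠ B →
    ∃ C, IsAtom C ∧ C ≤ A ⊔ B ∧ A ≤ B ⊔ C ∧ B ≤ A ⊔ C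

theorem HasThirdAtoms.map {α β : Type*} [Lattice α] [OrderBot α] [Lattice β] [OrderBot β]
    (e : α ≃o β) {S : α} (h : HasThirdAtoms S) : HasThirdAtoms (e S) := by
  intro A B hA hB hAS hBS hAB
  obtain ⟨C, hC, h1, h2, h3⟩ := h (e.symm A) (e.symm B) ((e.symm.isAtom_iff A).2 hA)
    ((e.symm.isAtom_iff B).2 hB) (e.symm_apply_le.2 hAS) (e.symm_apply_le.2 hBS)
    (e.symm.injective.ne hAB)
  refine ⟨e C, (e.isAtom_iff C).2 hC, ?_, ?_, ?_⟩
  · simpa using e.monotone h1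
  · simpa using e.monotone h2
  · simpa using e.monotone h3

/-- The third atom comes from the symmetric difference; cancellation recovers each generator from
the other two. -/
theorem Subalg.IsBoolean.hasThirdAtoms {S : Subalg L} (hS : S.IsBoolean) : HasThirdAtoms S := by
  intro A B hA hB hAS hBS hAB
  obtain ⟨a, ha, ha', rfl⟩ := isAtom_subalg_iff.1 hA
  obtain ⟨b, hb, hb', rfl⟩ := isAtom_subalg_iff.1 hB
  rw [fourSub_le] at hAS hBS
  have e := hS.omlSymmDiff_cancel hAS hBS
  have e' := hS.omlSymmDiff_cancel hBS hAS
  rw [omlSymmDiff_comm b a] at e'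
  refine ⟨fourSub (omlSymmDiff a b), isAtom_subalg_iff.2 ⟨_, ?_, ?_, rfl⟩,
    fourSub_le.2 ?_, fourSub_le.2 ?_, fourSub_le.2 ?_⟩
  · intro h
    rw [h, omlSymmDiff_bot] at e
    exact hAB (by rw [e])
  · intro h
    rw [h, omlSymmDiff_top] at e
    exact hAB (by rw [← e, fourSub_compl])
  · exact omlSymmDiff_mem (fourSub_le.1 le_sup_left) (fourSub_le.1 le_sup_right)
  · rw [← e']
    exact omlSymmDiff_mem (fourSub_le.1 le_sup_left) (e'.symm ▸ fourSub_le.1 le_sup_right)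
  · rw [← e]
    exact omlSymmDiff_mem (fourSub_le.1 le_sup_left) (e.symm ▸ fourSub_le.1 le_sup_right)

/-- For incompatible `a` and `b`, the third generator `w` is compatible with one of them. A Boolean
subalgebra containing that one and `w` also contains the other, a contradiction. -/
theorem HasThirdAtoms.isBoolean {S : Subalg L} (h : HasThirdAtoms S) : S.IsBoolean := by
  refine isBoolean_of_compatible fun a ha b hb => ?_
  by_contra hab
  have triv : ∀ x y : L, x = ⊥ ∨ x = ⊤ → Compatible x y ∧ Compatible y x := by
    intro x y hx
    have hxy : x ∈ fourSub y := mem_fourSub.2 (by tauto)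
    obtain ⟨T, hT, h1, h2⟩ := compatible_of_mem_fourSub hxy
    exact ⟨⟨T, hT, h2, h1⟩, ⟨T, hT, h1, h2⟩⟩
  have ha' : ¬ (a = ⊥ ∨ a = ⊤) := fun h' => hab (triv a b h').1
  have hb' : ¬ (b = ⊥ ∨ b = ⊤) := fun h' => hab (triv b a h').2
  rw [not_or] at ha' hb'
  have hne : fourSub a ≠ fourSub b := fun e =>
    hab (compatible_of_mem_fourSub (e ▸ self_mem_fourSub b))
  obtain ⟨C, hC, h1, h2, h3⟩ := h (fourSub a) (fourSub b)
    (isAtom_subalg_iff.2 ⟨a, ha'.1, ha'.2, rfl⟩) (isAtom_subalg_iff.2 ⟨b, hb'.1, hb'.2, rfl⟩)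
    (fourSub_le.2 ha) (fourSub_le.2 hb) hne
  obtain ⟨w, -, -, rfl⟩ := isAtom_subalg_iff.1 hC
  rcases compatible_or_compatible_of_mem_sup (fourSub_le.1 h1) with ⟨T, hT, haT, hwT⟩ | ⟨T, hT, hbT, hwT⟩
  · exact hab ⟨T, hT, haT,
      sup_le (fourSub_le.2 haT) (fourSub_le.2 hwT) (fourSub_le.1 h3)⟩
  · exact hab ⟨T, hT, sup_le (fourSub_le.2 hbT) (fourSub_le.2 hwT) (fourSub_le.1 h2), hbT⟩

/-! ### Induced isomorphisms -/

variable {M : Type*} [OrthomodularLattice M]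

/-- An isomorphism of subalgebra lattices restricts to the posets of Boolean subalgebras. -/
def BSub.congr (e : Subalg L ≃o Subalg M) : BSub L ≃o BSub M where
  toFun S := ⟨e S.1, (S.2.hasThirdAtoms.map e).isBoolean⟩
  invFun S := ⟨e.symm S.1, (S.2.hasThirdAtoms.map e.symm).isBoolean⟩
  left_inv S := Subtype.ext (e.symm_apply_apply S.1)
  right_inv S := Subtype.ext (e.apply_symm_apply S.1)
  map_rel_iff' {S T} := e.le_iff_le (x := S.1) (y := T.1)

/-- The underlying order isomorphism of an isomorphism of orthomodular lattices. -/
abbrev Iso.orderIso (f : Iso L M) : L ≃o M := f.toRelIso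

/-- The inverse of an isomorphism of orthomodular lattices. -/
def Iso.inverse (f : Iso L M) : Iso M L where
  toRelIso := f.orderIso.symm
  map_compl' a := by
    apply f.orderIso.injective
    change f.orderIso (f.orderIso.symm aᶜ) = f.toFun (f.orderIso.symm a)ᶜ
    rw [f.map_compl']
    change _ = (f.orderIso (f.orderIso.symm a))ᶜ
    rw [OrderIso.apply_symm_apply, OrderIso.apply_symm_apply]

/-- The preimage of a subalgebra under an isomorphism. -/
def Subalg.comap (f : Iso L M) (S : Subalg M) : Subalg L where
  carrier := {a | f.orderIso a ∈ S}
  bot_mem' := by simpa using S.bot_mem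
  top_mem' := by simpa using S.top_mem
  sup_mem' {a b} ha hb := by
    simpa using sup_mem (S := S) ha hb
  inf_mem' {a b} ha hb := by
    simpa using inf_mem (S := S) ha hb
  compl_mem' {a} ha := by
    change f.toFun aᶜ ∈ S
    rw [f.map_compl']
    exact compl_mem ha

/-- An isomorphism of orthomodular lattices induces one of their subalgebra lattices. -/
def Iso.subalgCongr (f : Iso L M) : Subalg L ≃o Subalg M where
  toFun := Subalg.comap f.inverse
  invFun := Subalg.comap f
  left_inv S := SetLike.ext fun a => by
    change f.orderIso.symm (f.orderIso a) ∈ S ↔ _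
    rw [OrderIso.symm_apply_apply]
  right_inv S := SetLike.ext fun a => by
    change f.orderIso (f.orderIso.symm a) ∈ S ↔ _
    rw [OrderIso.apply_symm_apply]
  map_rel_iff' {S T} := by
    refine ⟨fun h a ha => ?_, fun h a ha => h ha⟩
    have : f.orderIso a ∈ Subalg.comap f.inverse S := by
      change f.orderIso.symm (f.orderIso a) ∈ S
      rwa [OrderIso.symm_apply_apply]
    have h' : f.orderIso.symm (f.orderIso a) ∈ T := h this
    rwa [OrderIso.symm_apply_apply] at h'

end OrthomodularLattice

/-! ### Atoms of `BSub` and their eight-element covers -/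

namespace OrthomodularLattice

open Subalg

variable {L : Type*} [OrthomodularLattice L]

instance : OrderBot (BSub L) where
  bot := ⟨⊥, (isBoolean_fourSub ⊥).mono bot_le⟩
  bot_le S := (bot_le : ⊥ ≤ S.1)

/-- The Boolean subalgebra `{⊥, ⊤, a, aᶜ}` as a member of `BSub L`. -/
def four (a : L) : BSub L := ⟨fourSub a, isBoolean_fourSub a⟩

theorem four_le {a : L} {D : BSub L} : four a ≤ D ↔ a ∈ D.1 := fourSub_le

theorem four_compl (a : L) : four aᶜ = four a := Subtype.ext (fourSub_compl a)

theorem four_eq_bot_iff {a : L} : four a = ⊥ ↔ a = ⊥ ∨ a = ⊤ := by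
  rw [← fourSub_eq_bot_iff, Subtype.ext_iff]; rfl

theorem four_injective {a b : L} (hb : b ≠ ⊥) (hb' : b ≠ ⊤) (h : four a = four b) :
    b = a ∨ b = aᶜ := fourSub_injective hb hb' (congrArg Subtype.val h)

theorem isAtom_bsub_iff {S : BSub L} : IsAtom S ↔ ∃ a, a ≠ ⊥ ∧ a ≠ ⊤ ∧ S = four a := by
  have hiff : IsAtom S ↔ IsAtom S.1 := by
    constructor
    · refine fun h => ⟨fun h' => h.1 (Subtype.ext h'), fun T hT => ?_⟩
      exact congrArg Subtype.val (h.2 ⟨T, S.2.mono hT.le⟩ hT)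
    · exact fun h => ⟨fun h' => h.1 (congrArg Subtype.val h'), fun T hT =>
        Subtype.ext (h.2 T.1 hT)⟩
  rw [hiff, isAtom_subalg_iff]
  simp only [Subtype.ext_iff]
  rfl

/-- The Boolean subalgebra generated by orthogonal elements `p` and `q`. -/
def eight (p q : L) : BSub L :=
  ⟨decides {p, q, (p ⊔ q)ᶜ}, isBoolean_decides fun w hw =>
    eq_top_of_le_of_compl_le (p := p ⊔ q) (sup_le (hw p (by simp)) (hw q (by simp)))
      (hw _ (by simp))⟩

theorem left_mem_eight {p q : L} (h : q ≤ pᶜ) : p ∈ (eight p q).1 := by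
  rintro x (rfl | rfl | rfl)
  exacts [Or.inl le_rfl, Or.inr h, Or.inr (oml_compl_le le_sup_left)]

theorem right_mem_eight {p q : L} (h : q ≤ pᶜ) : q ∈ (eight p q).1 := by
  rintro x (rfl | rfl | rfl)
  exacts [Or.inr (oml_le_compl_comm.1 h), Or.inl le_rfl, Or.inr (oml_compl_le le_sup_right)]

theorem eq_of_mem_eight {p q x : L} (h : q ≤ pᶜ) (hx : x ∈ (eight p q).1) (hp : p ≤ x) :
    x = ⊤ ∨ x = p ⊔ q ∨ x = qᶜ ∨ x = p := by
  have h' := oml_le_compl_comm.1 h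
  rcases hx q (by simp) with hq | hq <;> rcases hx (p ⊔ q)ᶜ (by simp) with hr | hr
  · exact Or.inl (eq_top_of_le_of_compl_le (sup_le hp hq) hr)
  · exact Or.inr (Or.inl (le_antisymm (by simpa using oml_compl_le hr) (sup_le hp hq)))
  · refine Or.inr (Or.inr (Or.inl (le_antisymm (oml_le_compl_comm.1 hq) ?_)))
    rw [← sup_compl_inf_of_le h', ← oml_compl_sup]
    exact sup_le hp hr
  · refine Or.inr (Or.inr (Or.inr (le_antisymm ?_ hp)))
    exact (le_inf (by simpa using oml_compl_le hr) (oml_le_compl_comm.1 hq)).trans_eq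
      (sup_inf_compl_of_le_compl h')

theorem eight_le {p q : L} {D : BSub L} (h : q ≤ pᶜ) (hp : p ∈ D.1) (hq : q ∈ D.1) :
    eight p q ≤ D := by
  have key : ∀ x ∈ (eight p q).1, p ≤ x → x ∈ D.1 := by
    intro x hx hpx
    rcases eq_of_mem_eight h hx hpx with rfl | rfl | rfl | rfl
    exacts [top_mem _, sup_mem hp hq, compl_mem hq, hp]
  intro x hx
  rcases hx p (by simp) with h' | h'
  · exact key x hx h'
  · exact mem_of_compl_mem (key xᶜ (compl_mem hx) h')

theorem not_mem_four {p q : L} (h0 : q ≠ ⊥) (h : q ≤ pᶜ) (h1 : q ≠ pᶜ) : q ∉ (four p).1 := by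
  intro hq
  rcases mem_fourSub.1 hq with rfl | rfl | rfl | rfl
  · exact h0 rfl
  · exact h1 (top_le_iff.1 h).symm
  · exact h0 (eq_bot_of_le_of_le_compl le_rfl h)
  · exact h1 rfl

theorem four_covBy_eight {p q : L} (h0 : q ≠ ⊥) (h : q ≤ pᶜ) (h1 : q ≠ pᶜ) :
    four p ⋖ eight p q := by
  refine ⟨lt_of_le_not_ge (four_le.2 (left_mem_eight h))
    fun hle => not_mem_four h0 h h1 (hle (right_mem_eight h)), fun X hpX hX => ?_⟩
  have hp : p ∈ X.1 := four_le.1 hpX.le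
  obtain ⟨y, hy, hy'⟩ := SetLike.not_le_iff_exists.1 (show ¬ X.1 ≤ (four p).1 from hpX.not_ge)
  obtain ⟨x, hx, hx', hpx⟩ : ∃ x ∈ X.1, x ∉ (four p).1 ∧ p ≤ x := by
    rcases hX.le hy p (by simp) with h' | h'
    · exact ⟨y, hy, hy', h'⟩
    · exact ⟨yᶜ, compl_mem hy, fun h => hy' (mem_of_compl_mem h), h'⟩
  refine hX.not_ge (eight_le h hp ?_)
  rcases eq_of_mem_eight h (hX.le hx) hpx with rfl | rfl | rfl | rfl
  · exact absurd (top_mem _) hx'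
  · have e := sup_inf_compl_of_le_compl h
    rw [sup_comm] at e
    exact e ▸ inf_mem hx (compl_mem hp)
  · exact mem_of_compl_mem hx
  · exact absurd (self_mem_fourSub x) hx'

/-- An element `x` of `D` outside `four a` is the join of `x ⊓ a` and `x ⊓ aᶜ`. One of these must be
a proper nonzero part of `a` or `aᶜ`; it serves as `q`, with `p` the other side. -/
theorem exists_eight_of_four_covBy {a : L} {D : BSub L} (h : four a ⋖ D) :
    ∃ p q, (p = a ∨ p = aᶜ) ∧ q ≠ ⊥ ∧ q ≤ pᶜ ∧ q ≠ pᶜ ∧ D = eight p q := by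
  have ha : a ∈ D.1 := four_le.1 h.le
  obtain ⟨x, hx, hx'⟩ := SetLike.not_le_iff_exists.1 (show ¬ D.1 ≤ (four a).1 from h.lt.not_ge)
  obtain ⟨p, q, hp, hq, h0, h1, h2⟩ :
      ∃ p q, (p = a ∨ p = aᶜ) ∧ q ∈ D.1 ∧ q ≠ ⊥ ∧ q ≤ pᶜ ∧ q ≠ pᶜ := by
    by_contra hcon
    push Not at hcon
    have c1 : x ⊓ a = ⊥ ∨ x ⊓ a = a := by
      by_contra hc
      rw [not_or] at hc
      exact hc.2 (by simpa using hcon aᶜ (x ⊓ a) (Or.inr rfl) (inf_mem hx ha) hc.1 (by simp))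
    have c2 : x ⊓ aᶜ = ⊥ ∨ x ⊓ aᶜ = aᶜ := by
      by_contra hc
      rw [not_or] at hc
      exact hc.2 (hcon a (x ⊓ aᶜ) (Or.inl rfl) (inf_mem hx (compl_mem ha)) hc.1 (by simp))
    have e := D.2 x hx a ha aᶜ (compl_mem ha)
    rw [oml_sup_compl, inf_top_eq] at e
    refine hx' (mem_fourSub.2 ?_)
    rcases c1 with c1 | c1 <;> rcases c2 with c2 | c2 <;> rw [c1, c2] at e <;> simp at e <;>
      simp [e]
  have hpD : p ∈ D.1 := by rcases hp with rfl | rfl <;> simp [ha, compl_mem]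
  refine ⟨p, q, hp, h0, h1, h2, ?_⟩
  have hpa : four p = four a := by rcases hp with rfl | rfl <;> simp [four_compl]
  have hlt := (four_covBy_eight h0 h1 h2).lt
  rw [hpa] at hlt
  exact ((eight_le h1 hpD hq).lt_or_eq.resolve_left fun h' => h.2 hlt h').symm

/-! ### Orientations of covers -/

/-- `D` is an eight-element Boolean subalgebra having `p` as an atom. -/
def Orients (p : L) (D : BSub L) : Prop := four p ⋖ D ∧ ∀ x ∈ D.1, p ≤ x ∨ p ≤ xᶜ

theorem orients_eight {p q : L} (h0 : q ≠ ⊥) (h : q ≤ pᶜ) (h1 : q ≠ pᶜ) :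
    Orients p (eight p q) :=
  ⟨four_covBy_eight h0 h h1, fun _ hx => hx p (by simp)⟩

theorem orients_or_orients_compl {a : L} {D : BSub L} (h : four a ⋖ D) :
    Orients a D ∨ Orients aᶜ D := by
  obtain ⟨p, q, rfl | rfl, h0, h1, h2, rfl⟩ := exists_eight_of_four_covBy h
  exacts [Or.inl (orients_eight h0 h1 h2), Or.inr (orients_eight h0 h1 h2)]

theorem Orients.not_compl {a : L} {D : BSub L} (h : Orients a D) : ¬ Orients aᶜ D := by
  intro h'
  refine h.1.lt.not_ge fun x hx => ?_
  rintro p (rfl | rfl)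
  exacts [h.2 x hx, h'.2 x hx]

theorem Orients.exists_eight {p : L} {D : BSub L} (h : Orients p D) :
    ∃ q, q ≠ ⊥ ∧ q ≤ pᶜ ∧ q ≠ pᶜ ∧ D = eight p q := by
  obtain ⟨s, q, rfl | rfl, h0, h1, h2, rfl⟩ := exists_eight_of_four_covBy h.1
  · exact ⟨q, h0, h1, h2, rfl⟩
  · exact absurd (orients_eight h0 h1 h2) h.not_compl

theorem Orients.le_compl {p q : L} {D : BSub L} (hp : Orients p D) (hq : Orients q D)
    (hp0 : p ≠ ⊥) (hne : p ≠ q) : p ≤ qᶜ := by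
  rcases hp.2 q (four_le.1 hq.1.le) with h | h
  · rcases hq.2 p (four_le.1 hp.1.le) with h' | h'
    · exact absurd (le_antisymm h h') hne
    · exact absurd (eq_bot_of_le_of_le_compl le_rfl (h.trans h')) hp0
  · exact h

/-- The algebra with atoms `a`, `bᶜ` and `b ⊓ aᶜ` works. -/
theorem orients_of_lt {a b : L} (ha : a ≠ ⊥) (hb : b ≠ ⊤) (h : a < b) :
    ∃ D : BSub L, Orients a D ∧ Orients bᶜ D := by
  have h1 : bᶜ ≤ aᶜ := oml_compl_le h.le
  have hb' : bᶜ ≠ ⊥ := fun e => hb (oml_compl_inj (by simpa using e))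
  have hne : bᶜ ≠ aᶜ := fun e => h.ne' (oml_compl_inj e)
  refine ⟨eight a bᶜ, orients_eight hb' h1 hne, ?_⟩
  have e : eight a bᶜ = eight bᶜ a := Subtype.ext (by simp only [eight, sup_comm, Set.insert_comm])
  rw [e]
  exact orients_eight ha (by simpa using h.le) (by simpa using h.ne)

theorem eq_of_covBy_of_le {α : Type*} [PartialOrder α] {a b c : α} (hb : a ⋖ b) (hc : a ⋖ c)
    (h : b ≤ c) : b = c := h.lt_or_eq.resolve_left fun h' => hc.2 hb.lt h'

/-- An order-theoretic relation that, for covers `D₁`, `D₂` of the atom `A = four a`, says that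
they are oriented by complementary elements of `A`. -/
def Opposite {α : Type*} [PartialOrder α] (A D₁ D₂ : α) : Prop :=
  D₁ ≠ D₂ ∧ ∃ E, D₁ ≤ E ∧ D₂ ≤ E ∧ ∀ D, A ⋖ D → D ≤ E → D = D₁ ∨ D = D₂

theorem Opposite.map {α β : Type*} [PartialOrder α] [PartialOrder β] (e : α ≃o β) {A D₁ D₂ : α}
    (h : Opposite A D₁ D₂) : Opposite (e A) (e D₁) (e D₂) := by
  obtain ⟨hne, E, h1, h2, hE⟩ := h
  refine ⟨e.injective.ne hne, e E, e.monotone h1, e.monotone h2, fun D hAD hDE => ?_⟩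
  have hAD' : A ⋖ e.symm D := by
    rwa [← apply_covBy_apply_iff e, e.apply_symm_apply]
  refine (hE (e.symm D) hAD' (e.symm_apply_le.2 hDE)).imp ?_ ?_ <;>
    exact fun h => by rw [← h, e.apply_symm_apply]

/-- One cover splits `sᶜ`, the other `s`. The algebra `E` with both splittings has only two atoms
below each side, so it admits no further splitting of either. -/
theorem opposite_of_orients_compl {s : L} {D₁ D₂ : BSub L} (h₁ : Orients s D₁)
    (h₂ : Orients sᶜ D₂) : Opposite (four s) D₁ D₂ := by
  have hD₁ := h₁
  have hD₂ := h₂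
  obtain ⟨q₁, ha0, ha1, ha2, rfl⟩ := h₁.exists_eight
  obtain ⟨q₂, hb0, hb1, hb2, rfl⟩ := h₂.exists_eight
  rw [oml_compl_compl] at hb1 hb2
  refine ⟨fun e => hD₁.not_compl (e ▸ hD₂), ?_⟩
  have hb1' : q₂ ≤ sᶜᶜ := by simpa using hb1
  have ha1' := oml_le_compl_comm.1 ha1
  have hb1c : sᶜ ≤ q₂ᶜ := oml_compl_le hb1
  have hqq : q₁ ≤ q₂ᶜ := ha1.trans hb1c
  -- the atoms of the sixteen-element upper bound
  let P : Set L := {q₁, sᶜ ⊓ q₁ᶜ, q₂, s ⊓ q₂ᶜ}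
  have hP : ∀ w, (∀ p ∈ P, p ≤ w) → w = ⊤ := by
    intro w hw
    refine eq_top_of_le_of_compl_le (p := s) ?_ ?_
    · rw [← sup_compl_inf_of_le hb1, inf_comm]
      exact sup_le (hw _ (by simp [P])) (hw _ (by simp [P]))
    · rw [← sup_compl_inf_of_le ha1, inf_comm]
      exact sup_le (hw _ (by simp [P])) (hw _ (by simp [P]))
  let E : BSub L := ⟨decides P, isBoolean_decides hP⟩
  have hs : s ∈ E.1 := by
    rintro p (rfl | rfl | rfl | rfl)
    exacts [Or.inr ha1, Or.inr inf_le_left, Or.inl hb1, Or.inl inf_le_left]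
  have hq₁ : q₁ ∈ E.1 := by
    rintro p (rfl | rfl | rfl | rfl)
    exacts [Or.inl le_rfl, Or.inr inf_le_right, Or.inr (oml_le_compl_comm.1 hqq),
      Or.inr (inf_le_left.trans ha1')]
  have hq₂ : q₂ ∈ E.1 := by
    rintro p (rfl | rfl | rfl | rfl)
    exacts [Or.inr hqq, Or.inr (inf_le_left.trans hb1c), Or.inl le_rfl, Or.inr inf_le_right]
  refine ⟨E, eight_le ha1 hs hq₁, eight_le hb1' (compl_mem hs) hq₂, fun D hsD hDE => ?_⟩
  obtain ⟨p, q, hp, h0, h1, h2, rfl⟩ := exists_eight_of_four_covBy hsD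
  have hqE : q ∈ E.1 := hDE (right_mem_eight h1)
  have hqD := right_mem_eight h1
  have hsD' : s ∈ (eight p q).1 := four_le.1 hsD.le
  -- `t` is one of `s`, `sᶜ`, split by `x`, and `q ≤ tᶜ` is decided by the two parts of `tᶜ`
  have key : ∀ t x : L, x ≤ tᶜ → (x ≤ q ∨ x ≤ qᶜ) → (tᶜ ⊓ xᶜ ≤ q ∨ tᶜ ⊓ xᶜ ≤ qᶜ) → q ≤ tᶜ →
      q ≠ tᶜ → t ∈ (eight p q).1 → x ∈ (eight p q).1 := by
    intro t x hx hxq hyq hqt hqt' ht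
    rcases hxq with h | h <;> rcases hyq with h' | h'
    · refine absurd (le_antisymm hqt ?_) hqt'
      rw [← sup_compl_inf_of_le hx, inf_comm]
      exact sup_le h h'
    · have : q = x := by
        refine le_antisymm ?_ h
        rw [oml_le_compl_comm, oml_compl_inf, oml_compl_compl, oml_compl_compl] at h'
        have e := sup_inf_compl_of_le_compl hx
        rw [sup_comm] at e
        exact (le_inf h' hqt).trans_eq e
      exact this ▸ hqD
    · have : q = tᶜ ⊓ xᶜ := le_antisymm (le_inf hqt (oml_le_compl_comm.1 h)) h'
      have e : x = tᶜ ⊓ qᶜ := by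
        rw [this, oml_compl_inf, oml_compl_compl, oml_compl_compl, inf_comm, sup_comm,
          sup_inf_compl_of_le_compl hx]
      rw [e]
      exact inf_mem (compl_mem ht) (compl_mem hqD)
    · refine absurd (eq_bot_of_le_of_le_compl le_rfl (hqt.trans ?_)) h0
      rw [← sup_compl_inf_of_le hx, inf_comm]
      exact sup_le h h'
  rcases hp with rfl | rfl
  · left
    have := key p q₁ ha1 (hqE _ (by simp [P])) (hqE _ (by simp [P])) h1 h2 hsD'
    exact (eq_of_covBy_of_le hD₁.1 hsD (eight_le ha1 hsD' this)).symm
  · right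
    have := key sᶜ q₂ hb1' (hqE _ (by simp [P])) (hqE _ (by simp [P])) h1 h2 (compl_mem hsD')
    refine (eq_of_covBy_of_le ?_ hsD (eight_le hb1' (compl_mem hsD') this)).symm
    rw [← four_compl]
    exact hD₂.1

/-- Both covers split `sᶜ`, by `q₁` and `q₂`. In any Boolean upper bound their symmetric difference
splits `sᶜ` in a third way, giving a third cover. -/
theorem not_opposite_of_orients {s : L} {D₁ D₂ : BSub L} (h₁ : Orients s D₁)
    (h₂ : Orients s D₂) : ¬ Opposite (four s) D₁ D₂ := by
  rintro ⟨hne, E, hE₁, hE₂, hE⟩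
  have hD₁ := h₁.1
  have hD₂ := h₂.1
  obtain ⟨q₁, ha0, ha1, ha2, rfl⟩ := h₁.exists_eight
  obtain ⟨q₂, hb0, hb1, hb2, rfl⟩ := h₂.exists_eight
  have hs : s ∈ E.1 := hE₁ (left_mem_eight ha1)
  have hq₁ : q₁ ∈ E.1 := hE₁ (right_mem_eight ha1)
  have hq₂ : q₂ ∈ E.1 := hE₂ (right_mem_eight hb1)
  have n₁ : q₂ ∉ (eight s q₁).1 := fun h =>
    hne (eq_of_covBy_of_le hD₂ hD₁ (eight_le hb1 (left_mem_eight ha1) h)).symm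
  have n₂ : q₁ ∉ (eight s q₂).1 := fun h =>
    hne (eq_of_covBy_of_le hD₁ hD₂ (eight_le ha1 (left_mem_eight hb1) h))
  have c₁ := E.2.omlSymmDiff_cancel hq₁ hq₂
  have c₂ := E.2.omlSymmDiff_cancel hq₂ hq₁
  rw [omlSymmDiff_comm q₂ q₁] at c₂
  have hq3E : omlSymmDiff q₁ q₂ ∈ E.1 := omlSymmDiff_mem hq₁ hq₂
  have m₁ : omlSymmDiff q₁ q₂ ∉ (eight s q₁).1 := fun h =>
    n₁ (c₁ ▸ omlSymmDiff_mem (right_mem_eight ha1) h)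
  have m₂ : omlSymmDiff q₁ q₂ ∉ (eight s q₂).1 := fun h =>
    n₂ (c₂ ▸ omlSymmDiff_mem (right_mem_eight hb1) h)
  have l3 : omlSymmDiff q₁ q₂ ≤ sᶜ := sup_le (inf_le_left.trans ha1) (inf_le_left.trans hb1)
  have z3 : omlSymmDiff q₁ q₂ ≠ ⊥ := fun h => m₁ (h ▸ bot_mem _)
  have t3 : omlSymmDiff q₁ q₂ ≠ sᶜ := fun h => m₁ (h ▸ compl_mem (left_mem_eight ha1))
  rcases hE _ (four_covBy_eight z3 l3 t3) (eight_le l3 hs hq3E) with h | h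
  · exact m₁ (h ▸ right_mem_eight l3)
  · exact m₂ (h ▸ right_mem_eight l3)

end OrthomodularLattice

/-! ### Reconstructing the algebra from `BSub` -/

namespace OrthomodularLattice

open Subalg

variable {L M : Type*} [OrthomodularLattice L] [OrthomodularLattice M]

/-- The isomorphism `φ` takes `four a` to `four m`, and the orientations of the covers of `four a`
by `a` and `aᶜ` to orientations by `m` and `mᶜ`. -/
structure Carries (φ : BSub L ≃o BSub M) (a : L) (m : M) : Prop where
  four_eq : φ (four a) = four m
  orients : ∀ D, Orients a D → Orients m (φ D)
  orients_compl : ∀ D, Orients aᶜ D → Orients mᶜ (φ D)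

variable {φ : BSub L ≃o BSub M}

theorem Carries.compl {a : L} {m : M} (h : Carries φ a m) : Carries φ aᶜ mᶜ :=
  ⟨by rw [four_compl, four_compl, h.four_eq], h.orients_compl, by simpa using h.orients⟩

theorem covBy_map {a : L} {m : M} (h : φ (four a) = four m) {D : BSub L} (hD : four a ⋖ D) :
    four m ⋖ φ D := by
  rw [← h]; exact (apply_covBy_apply_iff φ).2 hD

theorem Carries.symm {a : L} {m : M} (h : Carries φ a m) : Carries φ.symm m a := by
  have h4 : φ.symm (four m) = four a := by rw [← h.four_eq, φ.symm_apply_apply]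
  refine ⟨h4, fun D hD => ?_, fun D hD => ?_⟩
  · refine (orients_or_orients_compl (covBy_map h4 hD.1)).resolve_right fun hc => ?_
    have := h.orients_compl _ hc
    rw [φ.apply_symm_apply] at this
    exact hD.not_compl this
  · have hc := covBy_map h4 ((four_compl m) ▸ hD.1)
    refine (orients_or_orients_compl hc).resolve_left fun hc => ?_
    have := h.orients _ hc
    rw [φ.apply_symm_apply] at this
    exact this.not_compl hD

/-- An isomorphism that transports the orientation of one cover of `four a` transports the
orientations of all of them. -/
theorem carries_of_orients {a : L} {m : M} (h4 : φ (four a) = four m) {D₀ : BSub L}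
    (h : Orients a D₀) (h' : Orients m (φ D₀)) : Carries φ a m := by
  refine ⟨h4, fun D hD => ?_, fun D hD => ?_⟩
  · refine (orients_or_orients_compl (covBy_map h4 hD.1)).resolve_right fun hc => ?_
    have := (opposite_of_orients_compl h' hc).map φ.symm
    rw [← h4, φ.symm_apply_apply, φ.symm_apply_apply, φ.symm_apply_apply] at this
    exact not_opposite_of_orients h hD this
  · refine (orients_or_orients_compl (covBy_map h4 (four_compl a ▸ hD.1))).resolve_left fun hc => ?_
    have := (opposite_of_orients_compl h hD).map φ
    rw [h4] at this
    exact not_opposite_of_orients h' hc this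

/-- A single oriented cover decides between `m` and `mᶜ`. With no cover, the orientation conditions
are vacuous and either choice works. -/
theorem exists_carries (φ : BSub L ≃o BSub M) {a : L} (h0 : a ≠ ⊥) (h1 : a ≠ ⊤) :
    ∃ m, Carries φ a m := by
  obtain ⟨m, -, -, hm⟩ := isAtom_bsub_iff.1
    ((φ.isAtom_iff _).2 (isAtom_bsub_iff.2 ⟨a, h0, h1, rfl⟩))
  have key : ∀ b : L, four b = four a → ∀ D₀, Orients b D₀ → ∃ n, Carries φ b n := by
    intro b hb D₀ hD₀
    have hbm : φ (four b) = four m := hb ▸ hm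
    rcases orients_or_orients_compl (covBy_map hbm hD₀.1) with h | h
    · exact ⟨m, carries_of_orients hbm hD₀ h⟩
    · exact ⟨mᶜ, carries_of_orients (by rw [hbm, four_compl]) hD₀ h⟩
  by_cases hD : ∃ D, Orients a D
  · obtain ⟨D, hD⟩ := hD
    exact key a rfl D hD
  · by_cases hD' : ∃ D, Orients aᶜ D
    · obtain ⟨D, hD'⟩ := hD'
      obtain ⟨n, hn⟩ := key aᶜ (four_compl a) D hD'
      exact ⟨nᶜ, by simpa using hn.compl⟩
    · exact ⟨m, hm, fun D h => absurd ⟨D, h⟩ hD, fun D h => absurd ⟨D, h⟩ hD'⟩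

theorem eq_bot_or_eq_top_compl {a : L} : (aᶜ = ⊥ ∨ aᶜ = ⊤) ↔ (a = ⊥ ∨ a = ⊤) := by
  rw [← four_eq_bot_iff, four_compl, four_eq_bot_iff]

theorem ne_compl_self [Nontrivial L] (a : L) : a ≠ aᶜ := by
  intro h
  have h1 : a = ⊥ := eq_bot_of_le_of_le_compl le_rfl h.le
  rw [h1, oml_compl_bot] at h
  exact bot_ne_top h

theorem ne_compl_of_le {a b : L} (h0 : a ≠ ⊥) (h : a ≤ b) : a ≠ bᶜ :=
  fun e => h0 (eq_bot_of_le_of_le_compl h e.le)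

/-- The carried elements can be chosen compatibly with orthocomplementation. -/
theorem exists_carrying_map [Nontrivial L] (φ : BSub L ≃o BSub M) :
    ∃ f : L → M, f ⊥ = ⊥ ∧ f ⊤ = ⊤ ∧ (∀ a, f aᶜ = (f a)ᶜ) ∧
      ∀ a, a ≠ ⊥ → a ≠ ⊤ → Carries φ a (f a) := by
  classical
  have hg : ∀ a : L, ∃ m, a ≠ ⊥ → a ≠ ⊤ → Carries φ a m := fun a => by
    by_cases h : a ≠ ⊥ ∧ a ≠ ⊤
    · obtain ⟨m, hm⟩ := exists_carries φ h.1 h.2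
      exact ⟨m, fun _ _ => hm⟩
    · exact ⟨⊥, fun h0 h1 => absurd ⟨h0, h1⟩ h⟩
  choose g hg using hg
  -- `g a` and `g aᶜ` were chosen independently and need not be complementary. Using `g` only at one
  -- representative of each pair, and complementing for the other, repairs this; it needs `a ≠ aᶜ`.
  let rep : BSub L → L := fun X => Classical.epsilon fun x => four x = X
  have hrep : ∀ a, a ≠ ⊥ → a ≠ ⊤ → rep (four a) = a ∨ rep (four a) = aᶜ := by
    intro a h0 h1
    have e : four (rep (four a)) = four a :=
      Classical.epsilon_spec (p := fun x => four x = four a) ⟨a, rfl⟩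
    have hnt : ¬ (rep (four a) = ⊥ ∨ rep (four a) = ⊤) := by
      rw [← four_eq_bot_iff, e, four_eq_bot_iff]; tauto
    rw [not_or] at hnt
    exact four_injective hnt.1 hnt.2 e.symm
  let f : L → M := fun a =>
    if a = ⊥ then ⊥ else if a = ⊤ then ⊤ else if rep (four a) = a then g a else (g aᶜ)ᶜ
  have f0 : f ⊥ = ⊥ := by simp [f]
  have f1 : f ⊤ = ⊤ := by simp [f]
  have fp : ∀ a, a ≠ ⊥ → a ≠ ⊤ → f a = if rep (four a) = a then g a else (g aᶜ)ᶜ :=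
    fun a h0 h1 => by simp [f, h0, h1]
  have hc : ∀ a : L, a ≠ ⊥ → a ≠ ⊤ → aᶜ ≠ ⊥ ∧ aᶜ ≠ ⊤ := fun a h0 h1 => by
    rw [← not_or, eq_bot_or_eq_top_compl]; tauto
  refine ⟨f, f0, f1, fun a => ?_, fun a h0 h1 => ?_⟩
  · by_cases h0 : a = ⊥
    · rw [h0, oml_compl_bot, f0, f1, oml_compl_bot]
    by_cases h1 : a = ⊤
    · rw [h1, oml_compl_top, f0, f1, oml_compl_top]
    rw [fp a h0 h1, fp aᶜ (hc a h0 h1).1 (hc a h0 h1).2, four_compl, oml_compl_compl]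
    rcases hrep a h0 h1 with h | h
    · simp [h, ne_compl_self]
    · simp [h, (ne_compl_self a).symm]
  · rw [fp a h0 h1]
    split_ifs
    · exact hg a h0 h1
    · simpa using (hg aᶜ (hc a h0 h1).1 (hc a h0 h1).2).compl

theorem Carries.ne_bot_top {a : L} {m : M} (h : Carries φ a m) (h0 : a ≠ ⊥) (h1 : a ≠ ⊤) :
    m ≠ ⊥ ∧ m ≠ ⊤ := by
  rw [← not_or, ← four_eq_bot_iff, ← h.four_eq, map_eq_bot_iff, four_eq_bot_iff]
  tauto

/-- The images `m` and `nᶜ` are atoms of one eight-element algebra. They are distinct by `hmn`,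
hence orthogonal. -/
theorem Carries.le {a b : L} {m n : M} (ha : Carries φ a m) (hb : Carries φ b n)
    (ha0 : a ≠ ⊥) (ha1 : a ≠ ⊤) (hb1 : b ≠ ⊤) (hmn : m ≠ nᶜ) (h : a < b) : m ≤ n := by
  obtain ⟨D, h1, h2⟩ := orients_of_lt ha0 hb1 h
  simpa using (ha.orients D h1).le_compl (hb.orients_compl D h2) (ha.ne_bot_top ha0 ha1).1 hmn

/-- An isomorphism of posets of Boolean subalgebras is induced by one of orthomodular lattices. -/
theorem nonempty_iso_of_bsub [Nontrivial L] [Nontrivial M] (φ : BSub L ≃o BSub M) :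
    Nonempty (Iso L M) := by
  obtain ⟨f, f0, f1, fc, hf⟩ := exists_carrying_map φ
  have proper : ∀ a, a ≠ ⊥ → a ≠ ⊤ → f a ≠ ⊥ ∧ f a ≠ ⊤ :=
    fun a h0 h1 => (hf a h0 h1).ne_bot_top h0 h1
  have bot_iff : ∀ a, f a = ⊥ → a = ⊥ := by
    intro a h
    by_contra h0
    by_cases h1 : a = ⊤
    · rw [h1, f1] at h; exact top_ne_bot h
    · exact (proper a h0 h1).1 h
  have top_iff : ∀ a, f a = ⊤ → a = ⊤ := by
    intro a h
    by_contra h1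
    by_cases h0 : a = ⊥
    · rw [h0, f0] at h; exact bot_ne_top h
    · exact (proper a h0 h1).2 h
  have inj : Function.Injective f := by
    intro a b h
    by_cases h0 : b = ⊥
    · rw [h0, f0] at h; rw [h0, bot_iff a h]
    by_cases h1 : b = ⊤
    · rw [h1, f1] at h; rw [h1, top_iff a h]
    have ha0 : a ≠ ⊥ := fun e => h0 (bot_iff b (by rw [← h, e, f0]))
    have ha1 : a ≠ ⊤ := fun e => h1 (top_iff b (by rw [← h, e, f1]))
    have e : φ (four a) = φ (four b) := by
      rw [(hf a ha0 ha1).four_eq, (hf b h0 h1).four_eq, h]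
    rcases four_injective h0 h1 (φ.injective e) with h' | h'
    · exact h'.symm
    · rw [h', fc] at h
      exact absurd h (ne_compl_self _)
  have surj : Function.Surjective f := by
    intro m
    by_cases h0 : m = ⊥
    · exact ⟨⊥, by rw [f0, h0]⟩
    by_cases h1 : m = ⊤
    · exact ⟨⊤, by rw [f1, h1]⟩
    obtain ⟨a, ha0, ha1, ha⟩ := isAtom_bsub_iff.1
      ((φ.symm.isAtom_iff _).2 (isAtom_bsub_iff.2 ⟨m, h0, h1, rfl⟩))
    have e : four (f a) = four m := by
      rw [← (hf a ha0 ha1).four_eq, ← ha, φ.apply_symm_apply]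
    rcases four_injective h0 h1 e with h | h
    exacts [⟨a, h.symm⟩, ⟨aᶜ, by rw [fc, h]⟩]
  have le_iff : ∀ a b, f a ≤ f b ↔ a ≤ b := by
    intro a b
    by_cases ha0 : a = ⊥
    · simp [ha0, f0]
    by_cases hb1 : b = ⊤
    · simp [hb1, f1]
    by_cases ha1 : a = ⊤
    · rw [ha1, f1, top_le_iff, top_le_iff]
      exact ⟨top_iff b, fun h => by rw [h, f1]⟩
    by_cases hb0 : b = ⊥
    · rw [hb0, f0, le_bot_iff, le_bot_iff]
      exact ⟨bot_iff a, fun h => by rw [h, f0]⟩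
    by_cases hab : a = b
    · simp [hab]
    constructor
    · intro h
      refine (hf a ha0 ha1).symm.le (hf b hb0 hb1).symm (proper a ha0 ha1).1 (proper a ha0 ha1).2
        (proper b hb0 hb1).2 ?_ (lt_of_le_of_ne h (inj.ne hab))
      exact fun e => ne_compl_of_le (proper a ha0 ha1).1 h (by rw [e, fc])
    · intro h
      refine (hf a ha0 ha1).le (hf b hb0 hb1) ha0 ha1 hb1 ?_ (lt_of_le_of_ne h hab)
      rw [← fc]
      exact inj.ne (ne_compl_of_le ha0 h)
  exact ⟨{ toEquiv := Equiv.ofBijective f ⟨inj, surj⟩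
           map_rel_iff' := fun {a b} => le_iff a b
           map_compl' := fc }⟩

end OrthomodularLattice

theorem mainTheorem3 {L : Type*} {M : Type*} [OrthomodularLattice L] [OrthomodularLattice M]
    [Nontrivial L] [Nontrivial M] :
    (Nonempty (OrthomodularLattice.BSub L ≃o OrthomodularLattice.BSub M) ↔
        Nonempty (OrthomodularLattice.Iso L M)) ∧
      (Nonempty (OrthomodularLattice.Subalg L ≃o OrthomodularLattice.Subalg M) ↔
        Nonempty (OrthomodularLattice.Iso L M)) ∧
      (Nonempty (OrthomodularLattice.BSub L ≃o OrthomodularLattice.BSub M) ↔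
        Nonempty (OrthomodularLattice.Subalg L ≃o OrthomodularLattice.Subalg M)) := by
  have h₁ : Nonempty (OrthomodularLattice.BSub L ≃o OrthomodularLattice.BSub M) →
      Nonempty (OrthomodularLattice.Iso L M) :=
    fun ⟨φ⟩ => OrthomodularLattice.nonempty_iso_of_bsub φ
  have h₂ : Nonempty (OrthomodularLattice.Iso L M) →
      Nonempty (OrthomodularLattice.Subalg L ≃o OrthomodularLattice.Subalg M) :=
    fun ⟨f⟩ => ⟨f.subalgCongr⟩
  have h₃ : Nonempty (OrthomodularLattice.Subalg L ≃o OrthomodularLattice.Subalg M) →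
      Nonempty (OrthomodularLattice.BSub L ≃o OrthomodularLattice.BSub M) :=
    fun ⟨e⟩ => ⟨OrthomodularLattice.BSub.congr e⟩
  exact ⟨⟨h₁, h₃ ∘ h₂⟩, ⟨h₁ ∘ h₃, h₂⟩, ⟨h₂ ∘ h₁, h₃⟩⟩
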